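/- Let $\Sigma$ be the set of all $z\in\mathbb{C}$ such that $$\Re\int_0^z\sqrt{\frac{(t-1)(t-z)(t-\bar z)}{t}}\,dt=0,$$ where the integral is taken along the straight segment from $0$ to $z$ and the square root is a continuous branch along the interior of this segment. (For $z\notin(1,\infty)$ the branch is unique up to sign, and for $z\in(1,\infty)$ up to independent signs on the two sides of $t=1$; the condition does not depend on the choice.) Then $\Sigma$ is symmetric with respect to the real axis, and $\Sigma=[0,1]\cup\Sigma^+\cup\Sigma^-$ is formed by three Jordan arcs: the segment $[0,1]$, and two curves $\Sigma^+$ and $\Sigma^-$ that emanate from $z=1$ and diverge to infinity, with $\Sigma^+\setminus\{1\}\subset\{\Im z>0\}$ and $\Sigma^-\setminus\{1\}\subset\{\Im z<0\}$. Here a curve emanating from $1$ and diverging to infinity is the image of a continuous injective map $\gamma:[0,\infty)\to\mathbb{C}$ with $\gamma(0)=1$ and $|\gamma(t)|\to\infty$ as $t\to\infty$. -/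

import Mathlib

open Set Filter Topology MeasureTheory

/-- The radicand `(t - 1) (t - z) (t - z̄) / t`. -/
noncomputable def radicand (z t : ℂ) : ℂ :=
  (t - 1) * (t - z) * (t - (starRingEnd ℂ) z) / t

/-- `w` is a continuous branch of the square root of `t ↦ radicand z t` along the open
straight segment `t = s z`, `0 < s < 1`, from `0` to `z`. -/
def IsSqrtBranch (z : ℂ) (w : ℝ → ℂ) : Prop :=
  ContinuousOn w (Ioo 0 1) ∧ ∀ s ∈ Ioo (0 : ℝ) 1, w s ^ 2 = radicand z (s * z)

/-- The set of all `z` with `Re ∫₀^z √((t - 1)(t - z)(t - z̄)/t) dt = 0`. The integral is taken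
along the straight segment `t = s z`, `dt = z ds`, with a continuous branch of the root. -/
def sigmaSet : Set ℂ :=
  {z | ∃ w : ℝ → ℂ, IsSqrtBranch z w ∧
    IntervalIntegrable (fun s => w s * z) volume 0 1 ∧
    (∫ s in (0 : ℝ)..1, w s * z).re = 0}

/-- `S` is a (compact) Jordan arc with endpoints `a` and `b`. -/
def IsJordanArc (S : Set ℂ) (a b : ℂ) : Prop :=
  ∃ γ : ℝ → ℂ, ContinuousOn γ (Icc 0 1) ∧ InjOn γ (Icc 0 1) ∧ γ 0 = a ∧ γ 1 = b ∧
    γ '' Icc 0 1 = S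

/-- `S` is a Jordan arc that emanates from `a` and diverges to infinity. -/
def IsJordanArcToInfinity (S : Set ℂ) (a : ℂ) : Prop :=
  ∃ γ : ℝ → ℂ, ContinuousOn γ (Ici 0) ∧ InjOn γ (Ici 0) ∧ γ 0 = a ∧
    Tendsto γ atTop (cocompact ℂ) ∧ γ '' Ici 0 = S

/-!
The set is symmetric because conjugating a branch for `z` gives a branch for `z̄`, so it suffices to
find its points `z = x + i y` with `y ≥ 0`.

Up to a negative factor, the square of the integrand `w s * z` is an explicit polynomial in `s`
(`IsSqrtBranch.mul_sq`). If `Re z ≤ 0`, or if `z` is real outside `[0, 1]`, the sign of this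
polynomial forces the real part of the integrand to be zero up to some parameter and nonzero of one
sign afterwards, so the integral cannot have zero real part. On `[0, 1]` the integrand is imaginary.

For `x, y > 0` the segment from `0` to `z` is deformed into the real segment from `0` to `x` followed
by the vertical segment from `x` to `z`, inside the strip `0 ≤ Im t ≤ y` where the integrand has a
branch that is holomorphic in the interior and continuous up to the boundary. In the coordinate
`ζ = √t` even the singularity at `0` disappears, and the deformation is
`intervalIntegral_radial_sub_radial`. The condition becomes `levelFun x y = 0`, where
`levelFun x y = y² * verticalPart x y - horizontalPart x y`. The horizontal part is zero for `x ≤ 1`,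
since the integrand is real up to the branch point `1`, and the vertical part is positive, so there
is no zero with `x ≤ 1`. On `[1, ∞)` the horizontal part grows strictly and without bound in `x`,
while the vertical part decreases (`endpointWeight_antitone`). Hence for each `y` there is exactly
one zero `x = sigmaAbscissa y ≥ 1`. It depends continuously on `y` and equals `1` at `y = 0`, so the
part of the set in the upper half plane is the graph of this function over `y > 0`.
-/

/-! ### Cauchy's theorem on a curvilinear triangle -/

/-- Cauchy's theorem on the curvilinear triangle swept by the segments from `0` to `r σ`,
`0 ≤ σ ≤ 1`: the integrals of `H` along the two straight sides differ by its integral along the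
curve `r`. It is the divergence theorem on the unit square in the coordinates `(u, σ) ↦ u * r σ`,
so `H` only has to be differentiable over the open square and continuous over the closed one. -/
theorem intervalIntegral_radial_sub_radial {H : ℂ → ℂ} {r r' : ℝ → ℂ}
    (hr : ∀ σ ∈ Icc (0 : ℝ) 1, HasDerivAt r (r' σ) σ)
    (hr' : ∀ σ ∈ Icc (0 : ℝ) 1, DifferentiableAt ℝ r' σ)
    (hc : ∀ u ∈ Icc (0 : ℝ) 1, ∀ σ ∈ Icc (0 : ℝ) 1, ContinuousAt H (u * r σ))
    (hd : ∀ u ∈ Ioo (0 : ℝ) 1, ∀ σ ∈ Ioo (0 : ℝ) 1, DifferentiableAt ℂ H (u * r σ)) :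
    (∫ u in (0 : ℝ)..1, H (u * r 1) * r 1) - ∫ u in (0 : ℝ)..1, H (u * r 0) * r 0 =
      ∫ σ in (0 : ℝ)..1, H (r σ) * r' σ := by
  have hrc : ContinuousOn (fun p : ℝ × ℝ => r p.2) (Icc 0 1 ×ˢ Icc 0 1) := fun p hp =>
    ((hr p.2 hp.2).continuousAt.comp (f := fun p : ℝ × ℝ => p.2)
      continuousAt_snd).continuousWithinAt
  have hrc' : ContinuousOn (fun p : ℝ × ℝ => r' p.2) (Icc 0 1 ×ˢ Icc 0 1) := fun p hp =>
    ((hr' p.2 hp.2).continuousAt.comp (f := fun p : ℝ × ℝ => p.2)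
      continuousAt_snd).continuousWithinAt
  have hu : Continuous (fun p : ℝ × ℝ => (p.1 : ℂ)) := by fun_prop
  have hH : ContinuousOn (fun p : ℝ × ℝ => H (p.1 * r p.2)) (Icc 0 1 ×ˢ Icc 0 1) := fun p hp =>
    (hc p.1 hp.1 p.2 hp.2).comp_continuousWithinAt (f := fun p : ℝ × ℝ => (p.1 : ℂ) * r p.2)
      ((hu.continuousOn.mul hrc) p hp)
  set f : ℝ × ℝ → ℂ := fun p => H (p.1 * r p.2) * (p.1 * r' p.2) with hf
  set g : ℝ × ℝ → ℂ := fun p => -(H (p.1 * r p.2) * r p.2) with hg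
  have key : ∀ p ∈ Ioo (0 : ℝ) 1 ×ˢ Ioo (0 : ℝ) 1, DifferentiableAt ℝ f p ∧
      DifferentiableAt ℝ g p ∧ fderiv ℝ f p (1, 0) + fderiv ℝ g p (0, 1) = 0 := by
    rintro ⟨u, σ⟩ ⟨hu0, hσ0⟩
    have hσ1 := Ioo_subset_Icc_self hσ0
    have du : HasFDerivAt (fun p : ℝ × ℝ => (p.1 : ℂ))
        (Complex.ofRealCLM.comp (ContinuousLinearMap.fst ℝ ℝ ℝ)) (u, σ) :=
      (Complex.ofRealCLM.comp (ContinuousLinearMap.fst ℝ ℝ ℝ)).hasFDerivAt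
    have dr := (hr σ hσ1).hasFDerivAt.comp (u, σ)
      (hasFDerivAt_snd (𝕜 := ℝ) (E := ℝ) (F := ℝ) (p := (u, σ)))
    have dr' := (hr' σ hσ1).hasDerivAt.hasFDerivAt.comp (u, σ)
      (hasFDerivAt_snd (𝕜 := ℝ) (E := ℝ) (F := ℝ) (p := (u, σ)))
    have dH := ((hd u hu0 σ hσ0).hasDerivAt.hasFDerivAt.restrictScalars ℝ).comp (u, σ)
      (du.mul dr)
    have df := dH.mul (du.mul dr')
    have dg := (dH.mul dr).neg
    refine ⟨df.differentiableAt, dg.differentiableAt, ?_⟩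
    have e1 := df.fderiv
    have e2 := dg.fderiv
    have e1' : fderiv ℝ f (u, σ) = _ := e1
    have e2' : fderiv ℝ g (u, σ) = _ := e2
    rw [e1', e2']
    simp
    ring
  have h01 : ∀ x ∈ Ioo (min (0:ℝ) 1) (max 0 1) ×ˢ Ioo (min (0:ℝ) 1) (max 0 1) \ (∅ : Set (ℝ × ℝ)),
      x ∈ Ioo (0 : ℝ) 1 ×ˢ Ioo (0 : ℝ) 1 := by
    intro x hx; simpa using hx
  have hae : (fun p : ℝ × ℝ => fderiv ℝ f p (1, 0) + fderiv ℝ g p (0, 1))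
      =ᵐ[volume.restrict (Icc (0 : ℝ) 1 ×ˢ Icc (0 : ℝ) 1)] 0 := by
    have : (Ioo (0 : ℝ) 1 ×ˢ Ioo (0 : ℝ) 1 : Set (ℝ × ℝ)) =ᵐ[volume]
        (Icc (0 : ℝ) 1 ×ˢ Icc (0 : ℝ) 1 : Set (ℝ × ℝ)) :=
      Measure.set_prod_ae_eq Ioo_ae_eq_Icc Ioo_ae_eq_Icc
    rw [← Measure.restrict_congr_set this]
    filter_upwards [ae_restrict_mem (measurableSet_Ioo.prod measurableSet_Ioo)] with p hp
    exact (key p hp).2.2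
  have main := integral2_divergence_prod_of_hasFDerivAt_off_countable f g (fderiv ℝ f) (fderiv ℝ g)
    0 0 1 1 ∅ countable_empty
    (by rw [uIcc_of_le zero_le_one]; exact hH.mul (hu.continuousOn.mul hrc'))
    (by rw [uIcc_of_le zero_le_one]; exact (hH.mul hrc).neg)
    (fun x hx => (key x (h01 x hx)).1.hasFDerivAt)
    (fun x hx => (key x (h01 x hx)).2.1.hasFDerivAt)
    (by
      rw [uIcc_of_le zero_le_one]
      exact (integrable_zero _ _ _).congr hae.symm)
  have hz : (∫ x in (0:ℝ)..1, ∫ y in (0:ℝ)..1,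
      fderiv ℝ f (x, y) (1, 0) + fderiv ℝ g (x, y) (0, 1)) = 0 := by
    have : ∀ x ∈ Ioo (0 : ℝ) 1, (∫ y in (0:ℝ)..1,
        fderiv ℝ f (x, y) (1, 0) + fderiv ℝ g (x, y) (0, 1)) = 0 := by
      intro x hx
      rw [intervalIntegral.integral_of_le zero_le_one, integral_Ioc_eq_integral_Ioo]
      exact setIntegral_eq_zero_of_forall_eq_zero fun y hy => (key (x, y) ⟨hx, hy⟩).2.2
    rw [intervalIntegral.integral_of_le zero_le_one, integral_Ioc_eq_integral_Ioo]
    exact setIntegral_eq_zero_of_forall_eq_zero this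
  rw [hz] at main
  simp only [hf, hg, Complex.ofReal_one, Complex.ofReal_zero, one_mul, zero_mul, mul_zero,
    intervalIntegral.integral_neg, intervalIntegral.integral_zero] at main
  linear_combination main

/-! ### A root of `1 - t` on the closed upper half plane -/

/-- The square root of `1 - t` that is continuous on the closed upper half plane, is nonnegative for
real `t ≤ 1`, and equals `-i √(t - 1)` for real `t ≥ 1`. The rotation by `i` moves the cut of the
principal root out of that half plane. -/
noncomputable def upperSqrtOneSub (t : ℂ) : ℂ :=
  (1 - Complex.I) * Complex.sqrt (Complex.I * (1 - t) / 2)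

theorem Complex.sq_sqrt_self (a : ℂ) : Complex.sqrt a ^ 2 = a := by
  rw [Complex.sqrt, ← Complex.cpow_nat_mul]; simp

theorem Complex.sqrt_re_nonneg (a : ℂ) : 0 ≤ (Complex.sqrt a).re := by
  rw [Complex.sqrt, Complex.cpow_inv_two_re]; positivity

theorem upperSqrtOneSub_sq (t : ℂ) : upperSqrtOneSub t ^ 2 = 1 - t := by
  rw [upperSqrtOneSub, mul_pow, Complex.sq_sqrt_self]
  linear_combination (-1 + t + Complex.I * (1 - t) / 2) * Complex.I_sq

theorem continuousAt_upperSqrtOneSub {t : ℂ} (ht : 0 ≤ t.im) :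
    ContinuousAt upperSqrtOneSub t := by
  have h : ContinuousAt Complex.sqrt (Complex.I * (1 - t) / 2) :=
    Complex.continuousAt_sqrt (Or.inl (by simp; linarith))
  unfold upperSqrtOneSub
  exact continuousAt_const.mul
    (ContinuousAt.comp (f := fun t : ℂ => Complex.I * (1 - t) / 2) h (by fun_prop))

theorem differentiableAt_upperSqrtOneSub {t : ℂ} (ht : 0 < t.im) :
    DifferentiableAt ℂ upperSqrtOneSub t := by
  have h : DifferentiableAt ℂ Complex.sqrt (Complex.I * (1 - t) / 2) :=
    Complex.differentiableAt_sqrt (Or.inl (by simp; linarith))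
  unfold upperSqrtOneSub
  exact (differentiableAt_const _).mul
    (DifferentiableAt.comp (f := fun t : ℂ => Complex.I * (1 - t) / 2) t h (by fun_prop))

theorem upperSqrtOneSub_re_nonneg_im_nonpos {t : ℂ} (ht : 0 ≤ t.im) :
    0 ≤ (upperSqrtOneSub t).re ∧ (upperSqrtOneSub t).im ≤ 0 := by
  have h0 := Complex.sqrt_re_nonneg (Complex.I * (1 - t) / 2)
  have h1 := congrArg Complex.re (Complex.sq_sqrt_self (Complex.I * (1 - t) / 2))
  unfold upperSqrtOneSub
  set w := Complex.sqrt (Complex.I * (1 - t) / 2)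
  have h2 : |w.im| ≤ w.re := by
    apply abs_le_of_sq_le_sq _ h0
    simp [pow_two] at h1
    nlinarith
  have := abs_le.1 h2
  simp
  constructor <;> linarith

theorem upperSqrtOneSub_re_pos_im_neg {t : ℂ} (ht : 0 < t.im) :
    0 < (upperSqrtOneSub t).re ∧ (upperSqrtOneSub t).im < 0 := by
  obtain ⟨h1, h2⟩ := upperSqrtOneSub_re_nonneg_im_nonpos ht.le
  have h3 := congrArg Complex.im (upperSqrtOneSub_sq t)
  simp [pow_two] at h3
  constructor
  · rcases h1.lt_or_eq with h | h
    · exact h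
    · rw [← h] at h3; simp at h3; linarith
  · rcases h2.lt_or_eq with h | h
    · exact h
    · rw [h] at h3; simp at h3; linarith

theorem upperSqrtOneSub_ofReal_im (t : ℝ) :
    (upperSqrtOneSub t).im = -√(t - 1) := by
  obtain ⟨h1, h2⟩ := upperSqrtOneSub_re_nonneg_im_nonpos (t := t) (by simp)
  have h3 := congrArg Complex.im (upperSqrtOneSub_sq t)
  have h4 := congrArg Complex.re (upperSqrtOneSub_sq t)
  simp [pow_two] at h3 h4
  set a := (upperSqrtOneSub t).re
  set b := (upperSqrtOneSub t).im
  have h5 : a = 0 ∨ b = 0 := by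
    rcases mul_eq_zero.1 (show a * b = 0 by linarith) with h | h <;> simp [h]
  rcases h5 with h | h
  · have : t - 1 = (-b) ^ 2 := by rw [h] at h4; linarith
    rw [this, Real.sqrt_sq (by linarith)]; ring
  · rw [Real.sqrt_eq_zero_of_nonpos (by rw [h] at h4; nlinarith), h]; simp

/-- The real part of the root of `1 / c - 1`, `c = x + i v`, lying in the closed right half plane. -/
noncomputable def endpointWeight (x v : ℝ) : ℝ :=
  √((‖(1 / (x + v * Complex.I) - 1 : ℂ)‖ + (1 / (x + v * Complex.I) - 1 : ℂ).re) / 2)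

theorem re_eq_sqrt_norm_add_re_of_sq_eq {h q : ℂ} (hq : h ^ 2 = q) (h0 : 0 ≤ h.re) :
    h.re = √((‖q‖ + q.re) / 2) := by
  have e1 : ‖q‖ = h.re ^ 2 + h.im ^ 2 := by
    rw [← hq, norm_pow, Complex.sq_norm, Complex.normSq_apply]; ring
  have e2 : q.re = h.re ^ 2 - h.im ^ 2 := by rw [← hq]; simp [pow_two]
  rw [e1, e2, show (h.re ^ 2 + h.im ^ 2 + (h.re ^ 2 - h.im ^ 2)) / 2 = h.re ^ 2 by ring,
    Real.sqrt_sq h0]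

theorem re_upperSqrtOneSub_div_sqrt_pos {c : ℂ} (hc : 0 < c.im) :
    0 < (upperSqrtOneSub c / Complex.sqrt c).re := by
  obtain ⟨h1, h2⟩ := upperSqrtOneSub_re_pos_im_neg hc
  have h3 := Complex.sqrt_re_nonneg c
  have h4 := congrArg Complex.im (Complex.sq_sqrt_self c)
  have hc0 : c ≠ 0 := by rintro rfl; simp at hc
  have hs0 : Complex.sqrt c ≠ 0 := by
    intro h; apply hc0; rw [← Complex.sq_sqrt_self c, h]; simp
  have h6 : (upperSqrtOneSub c / Complex.sqrt c) ^ 2 = 1 / c - 1 := by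
    rw [div_pow, upperSqrtOneSub_sq, Complex.sq_sqrt_self]; field_simp
  have h7 := congrArg Complex.im h6
  have h8 : (1 / c - 1).im < 0 := by
    simp [Complex.inv_im]
    rw [neg_div]
    have := div_pos hc (Complex.normSq_pos.2 hc0)
    linarith
  simp only [pow_two, Complex.mul_im] at h4
  have h9 : 0 < (Complex.sqrt c).im := by nlinarith
  have h10 : 0 < (Complex.sqrt c).re := by nlinarith
  have h5 : (upperSqrtOneSub c / Complex.sqrt c).im < 0 := by
    rw [Complex.div_im, ← sub_div]
    apply div_neg_of_neg_of_pos _ (Complex.normSq_pos.2 hs0)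
    nlinarith
  simp only [pow_two, Complex.mul_im] at h7
  nlinarith

theorem re_upperSqrtOneSub_div_sqrt {x v : ℝ} (hv : 0 < v) :
    (upperSqrtOneSub (x + v * Complex.I) / Complex.sqrt (x + v * Complex.I)).re =
      endpointWeight x v := by
  have hc : 0 < (x + v * Complex.I : ℂ).im := by simpa
  have hc0 : (x + v * Complex.I : ℂ) ≠ 0 := by
    intro h; rw [h] at hc; simp at hc
  refine re_eq_sqrt_norm_add_re_of_sq_eq ?_ (re_upperSqrtOneSub_div_sqrt_pos hc).le
  rw [div_pow, upperSqrtOneSub_sq, Complex.sq_sqrt_self]; field_simp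

/-! ### The contour integral along the ray and its real form -/

/-- The root of `(1 - t) (t - z) (t - z̄)`, `z = x + i y`, pulled back by `t = ζ ^ 2`, with the factor
`2` of `dt / √t = 2 dζ`. The substitution removes the singularity of the integrand at `t = 0`. -/
noncomputable def pulledRoot (x y : ℝ) (ζ : ℂ) : ℂ :=
  2 * upperSqrtOneSub (ζ ^ 2) * Complex.sqrt ((ζ ^ 2 - x) ^ 2 + y ^ 2)

/-- In the strip `0 ≤ Im t ≤ y`, the product `(t - z) (t - z̄) = (t - x)² + y²` keeps off the cut of
the principal root. -/
theorem sq_sub_add_sq_re_nonneg {x y : ℝ} {t : ℂ} (h0 : 0 ≤ t.im) (h1 : t.im ≤ y) :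
    0 ≤ ((t - x) ^ 2 + y ^ 2 : ℂ).re := by
  simp [pow_two]
  nlinarith [mul_self_nonneg (t.re - x)]

theorem continuousAt_pulledRoot {x y : ℝ} {ζ : ℂ} (h0 : 0 ≤ (ζ ^ 2).im) (h1 : (ζ ^ 2).im ≤ y) :
    ContinuousAt (pulledRoot x y) ζ := by
  have a : ContinuousAt (fun ζ : ℂ => upperSqrtOneSub (ζ ^ 2)) ζ :=
    ContinuousAt.comp (f := fun ζ : ℂ => ζ ^ 2) (continuousAt_upperSqrtOneSub h0) (by fun_prop)
  have b : ContinuousAt (fun ζ : ℂ => Complex.sqrt ((ζ ^ 2 - x) ^ 2 + y ^ 2)) ζ :=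
    ContinuousAt.comp (f := fun ζ : ℂ => (ζ ^ 2 - x) ^ 2 + (y : ℂ) ^ 2)
      (Complex.continuousAt_sqrt (Or.inl (sq_sub_add_sq_re_nonneg h0 h1))) (by fun_prop)
  exact (continuousAt_const.mul a).mul b

theorem differentiableAt_pulledRoot {x y : ℝ} {ζ : ℂ} (h0 : 0 < (ζ ^ 2).im)
    (h1 : (ζ ^ 2).im < y) : DifferentiableAt ℂ (pulledRoot x y) ζ := by
  have a : DifferentiableAt ℂ (fun ζ : ℂ => upperSqrtOneSub (ζ ^ 2)) ζ :=
    DifferentiableAt.comp (f := fun ζ : ℂ => ζ ^ 2) ζ (differentiableAt_upperSqrtOneSub h0)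
      (by fun_prop)
  have hs : (ζ ^ 2 - x) ^ 2 + (y : ℂ) ^ 2 ∈ Complex.slitPlane := by
    left
    generalize ζ ^ 2 = t at h0 h1
    simp [pow_two]
    nlinarith [mul_self_nonneg (t.re - x)]
  have b : DifferentiableAt ℂ (fun ζ : ℂ => Complex.sqrt ((ζ ^ 2 - x) ^ 2 + y ^ 2)) ζ :=
    DifferentiableAt.comp (f := fun ζ : ℂ => (ζ ^ 2 - x) ^ 2 + (y : ℂ) ^ 2) ζ
      (Complex.differentiableAt_sqrt hs) (by fun_prop)
  exact ((differentiableAt_const _).mul a).mul b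

/-- The contribution of the real axis to the contour integral, up to sign. `Real.sqrt` truncates
negative numbers to `0`, so only the part `u ^ 2 * x > 1` of the path, beyond the branch point `1`,
counts. -/
noncomputable def horizontalPart (x y : ℝ) : ℝ :=
  ∫ u in (0 : ℝ)..1, 2 * √x * √(u ^ 2 * x - 1) * √((u ^ 2 * x - x) ^ 2 + y ^ 2)

/-- The contribution of the vertical segment from `x` to `x + i y`, divided by `y ^ 2`. -/
noncomputable def verticalPart (x y : ℝ) : ℝ :=
  ∫ σ in (0 : ℝ)..1, √(1 - σ ^ 2) * endpointWeight x (σ * y)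

/-- The real function whose zeros with `x > 0`, `y > 0` are the points `x + i y` of `sigmaSet`. -/
noncomputable def levelFun (x y : ℝ) : ℝ := y ^ 2 * verticalPart x y - horizontalPart x y

theorem Complex.sqrt_ofReal_of_nonneg {a : ℝ} (ha : 0 ≤ a) : Complex.sqrt (a : ℂ) = (√a : ℝ) := by
  rw [Complex.sqrt_of_nonneg (by exact_mod_cast ha)]; simp

theorem im_intervalIntegral {f : ℝ → ℂ} {a b : ℝ} (hf : IntervalIntegrable f volume a b) :
    (∫ u in a..b, f u).im = ∫ u in a..b, (f u).im := by
  simpa using (Complex.imCLM.intervalIntegral_comp_comm hf).symm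

theorem re_intervalIntegral {f : ℝ → ℂ} {a b : ℝ} (hf : IntervalIntegrable f volume a b) :
    (∫ u in a..b, f u).re = ∫ u in a..b, (f u).re := by
  simpa using (Complex.reCLM.intervalIntegral_comp_comm hf).symm

theorem sq_ofReal_mul_sqrt_im (x y u σ : ℝ) :
    (((u : ℂ) * Complex.sqrt (x + σ * y * Complex.I)) ^ 2).im = u ^ 2 * (σ * y) := by
  rw [mul_pow, Complex.sq_sqrt_self]
  simp [← Complex.ofReal_pow, ← Complex.ofReal_mul]

theorem unit_sq_mul_mem {u σ y : ℝ} (hu : u ∈ Icc (0 : ℝ) 1) (hσ : σ ∈ Icc (0 : ℝ) 1)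
    (hy : 0 ≤ y) : 0 ≤ u ^ 2 * (σ * y) ∧ u ^ 2 * (σ * y) ≤ y := by
  refine ⟨mul_nonneg (sq_nonneg _) (mul_nonneg hσ.1 hy), ?_⟩
  have h1 : u ^ 2 ≤ 1 := pow_le_one₀ hu.1 hu.2
  have h2 : σ * y ≤ y := mul_le_of_le_one_left hy hσ.2
  have h3 := mul_nonneg hσ.1 hy
  nlinarith

theorem continuousOn_pulledRoot_ray {x y σ : ℝ} (hy : 0 ≤ y) (hσ : σ ∈ Icc (0 : ℝ) 1) :
    ContinuousOn (fun u : ℝ => pulledRoot x y (u * Complex.sqrt (x + σ * y * Complex.I)) *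
      Complex.sqrt (x + σ * y * Complex.I)) (Icc 0 1) := by
  intro u hu
  have h := unit_sq_mul_mem hu hσ hy
  rw [← sq_ofReal_mul_sqrt_im x] at h
  refine ContinuousAt.continuousWithinAt (ContinuousAt.mul ?_ continuousAt_const)
  exact ContinuousAt.comp (f := fun u : ℝ => (u : ℂ) * Complex.sqrt (x + σ * y * Complex.I))
    (continuousAt_pulledRoot h.1 h.2) (by fun_prop)

/-- Deformation of the segment from `0` to `z = x + i y` into the real segment from `0` to `x`
followed by the vertical one from `x` to `z`, in the coordinate `ζ = √t`. -/
theorem im_integral_pulledRoot_eq_levelFun {x y : ℝ} (hx : 0 < x) (hy : 0 < y) :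
    (∫ u in (0 : ℝ)..1, pulledRoot x y (u * Complex.sqrt (x + y * Complex.I)) *
      Complex.sqrt (x + y * Complex.I)).im = levelFun x y := by
  set c : ℝ → ℂ := fun σ => x + σ * y * Complex.I with hc
  set r : ℝ → ℂ := fun σ => Complex.sqrt (c σ) with hr
  have hcs : ∀ σ, c σ ∈ Complex.slitPlane := fun σ => Or.inl (by simpa [hc] using hx)
  have hr0 : ∀ σ, r σ ≠ 0 := fun σ h => by
    have := Complex.slitPlane_ne_zero (hcs σ)
    rw [← Complex.sq_sqrt_self (c σ)] at this
    exact this (by simp only [hr] at h; rw [h]; simp)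
  have hrd : ∀ σ, HasDerivAt r (y * Complex.I / (2 * r σ)) σ := by
    intro σ
    have h1 : HasDerivAt c (y * Complex.I) σ := by
      have := ((Complex.ofRealCLM.hasDerivAt (x := σ)).mul_const (y * Complex.I)).const_add (x : ℂ)
      simpa [hc, mul_assoc] using this
    have h2 := (Complex.differentiableAt_sqrt (hcs σ)).hasDerivAt.comp σ h1
    have h3 : HasDerivAt r _ σ := h2
    -- The derivative of `r` is read off from `r ^ 2 = c`.
    have h4 := h3.pow 2
    have h5 : (r ^ 2 : ℝ → ℂ) = c := by
      ext s; exact Complex.sq_sqrt_self (c s)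
    rw [h5] at h4
    have h6 := h4.unique h1
    convert h3 using 1
    rw [div_eq_iff (mul_ne_zero two_ne_zero (hr0 σ))]
    refine h6.symm.trans ?_
    simp; ring
  have key := intervalIntegral_radial_sub_radial (H := pulledRoot x y) (r := r)
    (r' := fun σ => y * Complex.I / (2 * r σ)) (fun σ _ => hrd σ)
    (fun σ _ => (differentiableAt_const _).div ((hrd σ).differentiableAt.const_mul 2)
      (mul_ne_zero two_ne_zero (hr0 σ)))
    (fun u hu σ hσ => by
      have h := unit_sq_mul_mem hu hσ hy.le
      rw [← sq_ofReal_mul_sqrt_im x] at h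
      exact continuousAt_pulledRoot h.1 h.2)
    (fun u hu σ hσ => by
      have h := sq_ofReal_mul_sqrt_im x y u σ
      refine differentiableAt_pulledRoot (h.symm ▸ ?_) (h.symm ▸ ?_)
      · exact mul_pos (pow_pos hu.1 2) (mul_pos hσ.1 hy)
      · have h1 : u ^ 2 < 1 := pow_lt_one₀ hu.1.le hu.2 two_ne_zero
        have h2 : σ * y < y := mul_lt_of_lt_one_left hy hσ.2
        have h3 := mul_pos hσ.1 hy
        nlinarith)
  have hr1 : r 1 = Complex.sqrt (x + y * Complex.I) := by simp [hr, hc]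
  have hr00 : r 0 = (√x : ℝ) := by
    simp only [hr, hc]; simpa using Complex.sqrt_ofReal_of_nonneg hx.le
  have hint0 : IntervalIntegrable (fun u : ℝ => pulledRoot x y (u * r 0) * r 0) volume 0 1 :=
    (continuousOn_pulledRoot_ray (x := x) hy.le (left_mem_Icc.2 zero_le_one)).intervalIntegrable_of_Icc
      zero_le_one
  have hrad : (∫ u in (0 : ℝ)..1, pulledRoot x y (u * r 0) * r 0).im = -horizontalPart x y := by
    rw [im_intervalIntegral hint0, horizontalPart, ← intervalIntegral.integral_neg]
    refine intervalIntegral.integral_congr fun u _ => ?_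
    have e : ((u : ℂ) * r 0) ^ 2 = ((u ^ 2 * x : ℝ) : ℂ) := by
      rw [mul_pow, hr00, ← Complex.ofReal_pow (√x), Real.sq_sqrt hx.le]; push_cast; ring
    have e2 : (((u ^ 2 * x : ℝ) : ℂ) - x) ^ 2 + (y : ℂ) ^ 2
        = (((u ^ 2 * x - x) ^ 2 + y ^ 2 : ℝ) : ℂ) := by push_cast; ring
    simp only [pulledRoot]
    rw [e, e2, Complex.sqrt_ofReal_of_nonneg (by positivity), hr00, Complex.im_mul_ofReal,
      Complex.im_mul_ofReal, Complex.mul_im, upperSqrtOneSub_ofReal_im]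
    simp
    ring
  have harc : (∫ σ in (0 : ℝ)..1, pulledRoot x y (r σ) * (y * Complex.I / (2 * r σ))).im =
      y ^ 2 * verticalPart x y := by
    have hI : IntervalIntegrable
        (fun σ => pulledRoot x y (r σ) * (y * Complex.I / (2 * r σ))) volume 0 1 := by
      refine ContinuousOn.intervalIntegrable_of_Icc zero_le_one fun σ hσ =>
        ContinuousAt.continuousWithinAt (ContinuousAt.mul ?_ ?_)
      · have h := unit_sq_mul_mem (right_mem_Icc.2 zero_le_one) hσ hy.le
        rw [← sq_ofReal_mul_sqrt_im x, Complex.ofReal_one, one_mul] at h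
        exact ContinuousAt.comp (f := r) (continuousAt_pulledRoot h.1 h.2) (hrd σ).continuousAt
      · exact continuousAt_const.div (continuousAt_const.mul (hrd σ).continuousAt)
          (mul_ne_zero two_ne_zero (hr0 σ))
    rw [im_intervalIntegral hI, verticalPart, ← intervalIntegral.integral_const_mul,
      intervalIntegral.integral_of_le zero_le_one, intervalIntegral.integral_of_le zero_le_one,
      integral_Ioc_eq_integral_Ioo, integral_Ioc_eq_integral_Ioo]
    refine setIntegral_congr_fun measurableSet_Ioo fun σ hσ => ?_
    have e : r σ ^ 2 = c σ := Complex.sq_sqrt_self (c σ)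
    have e2 : (c σ - x) ^ 2 + (y : ℂ) ^ 2 = ((y ^ 2 * (1 - σ ^ 2) : ℝ) : ℂ) := by
      simp only [hc]; push_cast; linear_combination (σ * y : ℂ) ^ 2 * Complex.I_sq
    have hσ2 : 0 ≤ 1 - σ ^ 2 := by nlinarith [hσ.1, hσ.2]
    have e3 : pulledRoot x y (r σ) * (y * Complex.I / (2 * r σ)) =
        ((y ^ 2 * √(1 - σ ^ 2) : ℝ) : ℂ) * ((upperSqrtOneSub (c σ) / r σ) * Complex.I) := by
      rw [pulledRoot, e, e2, Complex.sqrt_ofReal_of_nonneg (mul_nonneg (sq_nonneg _) hσ2),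
        Real.sqrt_mul (sq_nonneg _), Real.sqrt_sq hy.le]
      have := hr0 σ
      push_cast
      field_simp
    have e4 := re_upperSqrtOneSub_div_sqrt (x := x) (v := σ * y) (mul_pos hσ.1 hy)
    push_cast at e4
    rw [e3, Complex.im_ofReal_mul, Complex.mul_I_im, e4]
    ring
  rw [← hr1, ← sub_add_cancel (∫ u in (0 : ℝ)..1, pulledRoot x y (u * r 1) * r 1)
    (∫ u in (0 : ℝ)..1, pulledRoot x y (u * r 0) * r 0), key, Complex.add_im, hrad, harc, levelFun]
  ring

/-! ### The zero set of the level function -/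

/-- With `ρ = x² + v²`, the number `l = (endpointWeight x v)²` solves
`4 l (l ρ² + ρ (ρ - x)) = v²`. For `x ≥ 1` the left side increases with `x` and with `l ≥ 0`,
which makes `l` decrease with `x`. -/
theorem endpointWeight_sq (x v : ℝ) (h : x ^ 2 + v ^ 2 ≠ 0) :
    4 * endpointWeight x v ^ 2 * (endpointWeight x v ^ 2 * (x ^ 2 + v ^ 2) ^ 2 +
      (x ^ 2 + v ^ 2) * (x ^ 2 + v ^ 2 - x)) = v ^ 2 := by
  set q : ℂ := 1 / (x + v * Complex.I) - 1 with hq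
  have hn : Complex.normSq (x + v * Complex.I) = x ^ 2 + v ^ 2 := by
    simp [Complex.normSq_apply]; ring
  have hre : q.re = x / (x ^ 2 + v ^ 2) - 1 := by
    simp [hq, Complex.inv_re, -map_add]; simp [Complex.normSq_apply, pow_two]
  have him : q.im = -v / (x ^ 2 + v ^ 2) := by
    simp [hq, Complex.inv_im, -map_add]; simp [Complex.normSq_apply, pow_two]
  have hsq : endpointWeight x v ^ 2 = (‖q‖ + q.re) / 2 := by
    rw [endpointWeight, Real.sq_sqrt]
    have := (abs_le.1 (Complex.abs_re_le_norm q)).1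
    linarith
  have hnorm : ‖q‖ ^ 2 = q.re ^ 2 + q.im ^ 2 := by
    rw [Complex.sq_norm, Complex.normSq_apply]; ring
  have h2 : (2 * endpointWeight x v ^ 2 - q.re) ^ 2 = q.re ^ 2 + q.im ^ 2 := by
    rw [hsq, ← hnorm]; ring
  rw [hre, him] at h2
  field_simp at h2
  linear_combination h2

theorem endpointWeight_pos {x v : ℝ} (hv : 0 < v) : 0 < endpointWeight x v := by
  rw [← re_upperSqrtOneSub_div_sqrt hv]
  exact re_upperSqrtOneSub_div_sqrt_pos (by simpa)

theorem endpointWeight_nonneg (x v : ℝ) : 0 ≤ endpointWeight x v := Real.sqrt_nonneg _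

theorem endpointWeight_antitone {x₁ x₂ v : ℝ} (h1 : 1 ≤ x₁) (h12 : x₁ ≤ x₂) :
    endpointWeight x₂ v ≤ endpointWeight x₁ v := by
  by_contra! hlt
  have p1 : 0 < x₁ ^ 2 + v ^ 2 := by positivity
  have p12 : x₁ ^ 2 + v ^ 2 ≤ x₂ ^ 2 + v ^ 2 := by nlinarith
  have e1 := endpointWeight_sq x₁ v p1.ne'
  have e2 := endpointWeight_sq x₂ v (p1.trans_le p12).ne'
  have hl : endpointWeight x₁ v ^ 2 < endpointWeight x₂ v ^ 2 :=
    pow_lt_pow_left₀ hlt (endpointWeight_nonneg _ _) two_ne_zero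
  have hd1 : 0 ≤ x₁ ^ 2 + v ^ 2 - x₁ := by nlinarith [sq_nonneg v]
  have hd12 : x₁ ^ 2 + v ^ 2 - x₁ ≤ x₂ ^ 2 + v ^ 2 - x₂ := by nlinarith
  have hl0 : 0 ≤ endpointWeight x₁ v ^ 2 := sq_nonneg _
  generalize endpointWeight x₁ v ^ 2 = l₁ at *
  generalize endpointWeight x₂ v ^ 2 = l₂ at *
  generalize x₁ ^ 2 + v ^ 2 - x₁ = d₁ at *
  generalize x₂ ^ 2 + v ^ 2 - x₂ = d₂ at *
  generalize x₁ ^ 2 + v ^ 2 = ρ₁ at *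
  generalize x₂ ^ 2 + v ^ 2 = ρ₂ at *
  have hl2 : 0 < l₂ := hl0.trans_lt hl
  have : 4 * l₁ * (l₁ * ρ₁ ^ 2 + ρ₁ * d₁) < 4 * l₂ * (l₂ * ρ₂ ^ 2 + ρ₂ * d₂) := by
    have a : l₁ * ρ₁ ^ 2 < l₂ * ρ₂ ^ 2 := by
      calc l₁ * ρ₁ ^ 2 < l₂ * ρ₁ ^ 2 := by gcongr
        _ ≤ l₂ * ρ₂ ^ 2 := by gcongr
    have b : ρ₁ * d₁ ≤ ρ₂ * d₂ := mul_le_mul p12 hd12 hd1 (p1.le.trans p12)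
    have c : 0 ≤ l₁ * ρ₁ ^ 2 + ρ₁ * d₁ := by positivity
    calc 4 * l₁ * (l₁ * ρ₁ ^ 2 + ρ₁ * d₁) ≤ 4 * l₂ * (l₁ * ρ₁ ^ 2 + ρ₁ * d₁) := by gcongr
      _ < 4 * l₂ * (l₂ * ρ₂ ^ 2 + ρ₂ * d₂) :=
        mul_lt_mul_of_pos_left (by linarith) (by positivity)
  linarith

theorem continuous_endpointWeight {α : Type*} [TopologicalSpace α] {f g : α → ℝ}
    (hf : Continuous f) (hg : Continuous g) (h0 : ∀ a, 0 < f a) :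
    Continuous fun a => endpointWeight (f a) (g a) := by
  have hq : Continuous fun a => (1 / (f a + g a * Complex.I) - 1 : ℂ) := by
    refine (continuous_const.div (by fun_prop) fun a h => ?_).sub continuous_const
    have := congrArg Complex.re h
    simp at this
    exact (h0 a).ne' this
  unfold endpointWeight
  exact ((hq.norm.add (Complex.continuous_re.comp hq)).div_const 2).sqrt

theorem continuous_verticalPart {f g : ℝ → ℝ} (hf : Continuous f) (hg : Continuous g)
    (h0 : ∀ a, 0 < f a) : Continuous fun a => verticalPart (f a) (g a) := by
  refine intervalIntegral.continuous_parametric_intervalIntegral_of_continuous'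
    (f := fun a σ => √(1 - σ ^ 2) * endpointWeight (f a) (σ * g a)) ?_ 0 1
  refine Continuous.mul (by fun_prop) (continuous_endpointWeight (f := fun p : ℝ × ℝ => f p.1)
    (g := fun p : ℝ × ℝ => p.2 * g p.1) (by fun_prop) (by fun_prop) fun p => h0 p.1)

theorem continuous_horizontalPart {f g : ℝ → ℝ} (hf : Continuous f) (hg : Continuous g) :
    Continuous fun a => horizontalPart (f a) (g a) := by
  refine intervalIntegral.continuous_parametric_intervalIntegral_of_continuous'
    (f := fun a u => 2 * √(f a) * √(u ^ 2 * f a - 1) * √((u ^ 2 * f a - f a) ^ 2 + g a ^ 2))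
    ?_ 0 1
  simp only [Function.uncurry_def]
  fun_prop

theorem continuous_levelFun_left {x : ℝ} (hx : 0 < x) : Continuous fun y => levelFun x y :=
  ((continuous_pow 2).mul (continuous_verticalPart continuous_const continuous_id
    fun _ => hx)).sub (continuous_horizontalPart continuous_const continuous_id)

theorem continuousOn_levelFun_right (y : ℝ) : ContinuousOn (fun x => levelFun x y) (Ici 1) := by
  have h : Continuous fun x => levelFun (max x 1) y :=
    (continuous_const.mul (continuous_verticalPart (by fun_prop) continuous_const
      fun _ => by positivity)).sub (continuous_horizontalPart (by fun_prop) continuous_const)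
  exact h.continuousOn.congr fun x hx => by simp [max_eq_left (mem_Ici.1 hx)]

theorem continuous_verticalPart_integrand {x : ℝ} (hx : 0 < x) (y : ℝ) :
    Continuous fun σ : ℝ => √(1 - σ ^ 2) * endpointWeight x (σ * y) :=
  Continuous.mul (by fun_prop)
    (continuous_endpointWeight continuous_const (by fun_prop) fun _ => hx)

theorem verticalPart_antitone {x₁ x₂ y : ℝ} (h1 : 1 ≤ x₁) (h12 : x₁ ≤ x₂) :
    verticalPart x₂ y ≤ verticalPart x₁ y := by
  refine intervalIntegral.integral_mono_on zero_le_one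
    ((continuous_verticalPart_integrand (by linarith) y).intervalIntegrable _ _)
    ((continuous_verticalPart_integrand (by linarith) y).intervalIntegrable _ _) fun σ _ => ?_
  gcongr
  exact endpointWeight_antitone h1 h12

theorem verticalPart_pos {x y : ℝ} (hx : 0 < x) (hy : 0 < y) : 0 < verticalPart x y := by
  refine intervalIntegral.intervalIntegral_pos_of_pos_on
    ((continuous_verticalPart_integrand hx y).intervalIntegrable _ _) (fun σ hσ => ?_) one_pos
  have : 0 < 1 - σ ^ 2 := by nlinarith [hσ.1, hσ.2]
  exact mul_pos (Real.sqrt_pos.2 this) (endpointWeight_pos (mul_pos hσ.1 hy))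

theorem horizontalPart_eq_zero {x : ℝ} (h0 : 0 ≤ x) (hx : x ≤ 1) (y : ℝ) :
    horizontalPart x y = 0 := by
  have : ∀ u ∈ uIcc (0 : ℝ) 1,
      2 * √x * √(u ^ 2 * x - 1) * √((u ^ 2 * x - x) ^ 2 + y ^ 2) = 0 := by
    intro u hu
    rw [uIcc_of_le zero_le_one] at hu
    have : u ^ 2 * x ≤ 1 := mul_le_one₀ (pow_le_one₀ hu.1 hu.2) h0 hx
    rw [Real.sqrt_eq_zero_of_nonpos (x := u ^ 2 * x - 1) (by linarith)]
    ring
  rw [horizontalPart, intervalIntegral.integral_congr this, intervalIntegral.integral_zero]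

theorem horizontalPart_nonneg (x y : ℝ) : 0 ≤ horizontalPart x y :=
  intervalIntegral.integral_nonneg zero_le_one fun _ _ => by positivity

/-- Every factor of the integrand of `horizontalPart` is monotone in `x`; the factor `√x` is kept as
a gain, giving both strict growth and divergence. -/
theorem sqrt_mul_horizontalPart_le {x₁ x₂ y : ℝ} (h0 : 0 < x₁) (h12 : x₁ ≤ x₂) :
    √(x₂ / x₁) * horizontalPart x₁ y ≤ horizontalPart x₂ y := by
  rw [horizontalPart, horizontalPart, ← intervalIntegral.integral_const_mul]
  refine intervalIntegral.integral_mono_on zero_le_one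
    (Continuous.intervalIntegrable (by fun_prop) _ _)
    (Continuous.intervalIntegrable (by fun_prop) _ _) fun u _ => ?_
  have e : √(x₂ / x₁) * √x₁ = √x₂ := by
    rw [← Real.sqrt_mul (div_nonneg (h0.le.trans h12) h0.le), div_mul_cancel₀ _ h0.ne']
  have e2 : (u ^ 2 * x₁ - x₁) ^ 2 ≤ (u ^ 2 * x₂ - x₂) ^ 2 := by
    rw [show (u ^ 2 * x₁ - x₁) ^ 2 = (u ^ 2 - 1) ^ 2 * x₁ ^ 2 by ring,
      show (u ^ 2 * x₂ - x₂) ^ 2 = (u ^ 2 - 1) ^ 2 * x₂ ^ 2 by ring]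
    gcongr
  calc √(x₂ / x₁) * (2 * √x₁ * √(u ^ 2 * x₁ - 1) * √((u ^ 2 * x₁ - x₁) ^ 2 + y ^ 2))
      = 2 * (√(x₂ / x₁) * √x₁) * √(u ^ 2 * x₁ - 1) * √((u ^ 2 * x₁ - x₁) ^ 2 + y ^ 2) := by ring
    _ ≤ 2 * √x₂ * √(u ^ 2 * x₂ - 1) * √((u ^ 2 * x₂ - x₂) ^ 2 + y ^ 2) := by
      rw [e]; gcongr

theorem horizontalPart_pos {x : ℝ} (hx : 1 < x) (y : ℝ) : 0 < horizontalPart x y := by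
  have hx0 : 0 < x := by linarith
  have hc : Continuous fun u : ℝ =>
      2 * √x * √(u ^ 2 * x - 1) * √((u ^ 2 * x - x) ^ 2 + y ^ 2) := by fun_prop
  have h1 : 1 / x < 1 := by rw [div_lt_one hx0]; exact hx
  obtain ⟨t, ht1, ht2⟩ := exists_between h1
  have ht0 : 0 < t := lt_trans (by positivity) ht1
  rw [div_lt_iff₀ hx0] at ht1
  refine intervalIntegral.integral_pos one_pos hc.continuousOn (fun _ _ => by positivity)
    ⟨√t, ⟨Real.sqrt_nonneg _, Real.sqrt_le_one.2 ht2.le⟩, ?_⟩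
  rw [Real.sq_sqrt ht0.le]
  have a : 0 < t * x - 1 := by linarith
  have b : 0 < (t * x - x) ^ 2 + y ^ 2 := by
    have : t * x - x ≠ 0 := by nlinarith
    positivity
  positivity

theorem levelFun_pos_of_le_one {x y : ℝ} (h0 : 0 < x) (h1 : x ≤ 1) (hy : 0 < y) :
    0 < levelFun x y := by
  rw [levelFun, horizontalPart_eq_zero h0.le h1, sub_zero]
  exact mul_pos (by positivity) (verticalPart_pos h0 hy)

theorem levelFun_strictAntiOn (y : ℝ) : StrictAntiOn (fun x => levelFun x y) (Ici 1) := by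
  intro x₁ h1 x₂ _ h12
  have h1' : (1 : ℝ) ≤ x₁ := h1
  have hv := verticalPart_antitone (y := y) h1' h12.le
  have hh : horizontalPart x₁ y < horizontalPart x₂ y := by
    have h2 := horizontalPart_pos (h1'.trans_lt h12) y
    have h3 := sqrt_mul_horizontalPart_le (y := y) (by linarith : 0 < x₁) h12.le
    have h4 : 1 < √(x₂ / x₁) := by
      rw [Real.lt_sqrt zero_le_one, one_pow, one_lt_div (by linarith)]; exact h12
    rcases (horizontalPart_nonneg x₁ y).eq_or_lt with h | h
    · rwa [← h]
    · nlinarith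
  have : y ^ 2 * verticalPart x₂ y ≤ y ^ 2 * verticalPart x₁ y := by gcongr
  simp only [levelFun]
  linarith

theorem exists_levelFun_neg (y : ℝ) : ∃ x, 1 ≤ x ∧ levelFun x y < 0 := by
  have h2 := horizontalPart_pos (one_lt_two) y
  obtain ⟨b, hb⟩ : ∃ b, b = y ^ 2 * verticalPart 1 y / horizontalPart 2 y := ⟨_, rfl⟩
  have hx : (2 : ℝ) ≤ 2 * ((b + 1) ^ 2 + 1) := by nlinarith [sq_nonneg (b + 1)]
  -- `horizontalPart` exceeds `b * horizontalPart 2 y` as soon as `√(x / 2) > b`.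
  refine ⟨2 * ((b + 1) ^ 2 + 1), by linarith, ?_⟩
  have h3 := sqrt_mul_horizontalPart_le (y := y) two_pos hx
  have h4 := verticalPart_antitone (y := y) le_rfl (by linarith : 1 ≤ 2 * ((b + 1) ^ 2 + 1))
  rw [mul_div_cancel_left₀ _ two_ne_zero] at h3
  have h5 : b < √((b + 1) ^ 2 + 1) :=
    lt_of_lt_of_le (by linarith) (Real.le_sqrt_of_sq_le (by linarith : (b + 1) ^ 2 ≤ _))
  have h6 : b * horizontalPart 2 y = y ^ 2 * verticalPart 1 y := by rw [hb]; field_simp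
  have h7 : b * horizontalPart 2 y < √((b + 1) ^ 2 + 1) * horizontalPart 2 y := by gcongr
  have : y ^ 2 * verticalPart (2 * ((b + 1) ^ 2 + 1)) y ≤ y ^ 2 * verticalPart 1 y := by gcongr
  rw [levelFun]
  linarith

theorem levelFun_one_nonneg (y : ℝ) : 0 ≤ levelFun 1 y := by
  rw [levelFun, horizontalPart_eq_zero zero_le_one le_rfl, sub_zero]
  refine mul_nonneg (sq_nonneg _) (intervalIntegral.integral_nonneg zero_le_one fun σ _ => ?_)
  exact mul_nonneg (Real.sqrt_nonneg _) (endpointWeight_nonneg _ _)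

theorem exists_levelFun_eq_zero (y : ℝ) : ∃ x, 1 ≤ x ∧ levelFun x y = 0 := by
  obtain ⟨b, hb, hneg⟩ := exists_levelFun_neg y
  obtain ⟨x, hx, h0⟩ := intermediate_value_Icc' hb
    ((continuousOn_levelFun_right y).mono Icc_subset_Ici_self) ⟨hneg.le, levelFun_one_nonneg y⟩
  exact ⟨x, hx.1, h0⟩

/-- The abscissa `x ≥ 1` of the only zero of `levelFun · y` on `[1, ∞)`. For `y = 0` it is `1`, the
point from which the curves emanate. -/
noncomputable def sigmaAbscissa (y : ℝ) : ℝ := (exists_levelFun_eq_zero y).choose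

theorem one_le_sigmaAbscissa (y : ℝ) : 1 ≤ sigmaAbscissa y :=
  (exists_levelFun_eq_zero y).choose_spec.1

theorem levelFun_sigmaAbscissa (y : ℝ) : levelFun (sigmaAbscissa y) y = 0 :=
  (exists_levelFun_eq_zero y).choose_spec.2

theorem levelFun_eq_zero_iff {x y : ℝ} (hx : 1 ≤ x) :
    levelFun x y = 0 ↔ x = sigmaAbscissa y :=
  ⟨fun h => (levelFun_strictAntiOn y).injOn hx (one_le_sigmaAbscissa y)
    (h.trans (levelFun_sigmaAbscissa y).symm), fun h => h ▸ levelFun_sigmaAbscissa y⟩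

theorem sigmaAbscissa_zero : sigmaAbscissa 0 = 1 :=
  ((levelFun_eq_zero_iff le_rfl).1 (by
    rw [levelFun, horizontalPart_eq_zero zero_le_one le_rfl]; simp)).symm

/-- Strict monotonicity in `x` traps the zero between two abscissas at which the sign of `levelFun`
persists for nearby `y`. -/
theorem continuous_sigmaAbscissa : Continuous sigmaAbscissa := by
  rw [continuous_iff_continuousAt]
  intro y₀
  refine tendsto_order.2 ⟨fun a ha => ?_, fun a ha => ?_⟩
  · rcases lt_or_ge a 1 with h | h
    · exact Eventually.of_forall fun y => h.trans_le (one_le_sigmaAbscissa y)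
    · have h1 : 0 < levelFun a y₀ := by
        rw [← levelFun_sigmaAbscissa y₀]
        exact levelFun_strictAntiOn y₀ h (one_le_sigmaAbscissa y₀) ha
      filter_upwards [(continuous_levelFun_left (by linarith : 0 < a)).continuousAt.eventually
        (lt_mem_nhds h1)] with y hy
      rw [← levelFun_sigmaAbscissa y] at hy
      exact ((levelFun_strictAntiOn y).lt_iff_gt (one_le_sigmaAbscissa y) h).1 hy
  · have h : 1 ≤ a := (one_le_sigmaAbscissa y₀).trans ha.le
    have h1 : levelFun a y₀ < 0 := by
      rw [← levelFun_sigmaAbscissa y₀]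
      exact levelFun_strictAntiOn y₀ (one_le_sigmaAbscissa y₀) h ha
    filter_upwards [(continuous_levelFun_left (by linarith : 0 < a)).continuousAt.eventually
      (gt_mem_nhds h1)] with y hy
    rw [← levelFun_sigmaAbscissa y] at hy
    exact ((levelFun_strictAntiOn y).lt_iff_gt h (one_le_sigmaAbscissa y)).1 hy

/-! ### Square root branches and membership in `sigmaSet` -/

open ComplexConjugate in
/-- Since `t - z = -(1 - s) z` for `t = s z`, the square of the integrand is the negative number
`-(1 - s) / s` times a polynomial in `s`. -/
theorem IsSqrtBranch.mul_sq {z : ℂ} {w : ℝ → ℂ} (hw : IsSqrtBranch z w) (hz : z ≠ 0) {s : ℝ}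
    (hs : s ∈ Ioo (0 : ℝ) 1) :
    (w s * z) ^ 2 = ((-((1 - s) / s) : ℝ) : ℂ) * (z * (1 - s * z) * (z * conj z - s * z ^ 2)) := by
  have hs0 : (s : ℂ) ≠ 0 := by exact_mod_cast hs.1.ne'
  rw [mul_pow, hw.2 s hs, radicand]
  push_cast
  field_simp
  ring

/-- The radicand is bounded by a multiple of `1 / s`, so each branch is integrable. -/
theorem IsSqrtBranch.intervalIntegrable {z : ℂ} {w : ℝ → ℂ} (hw : IsSqrtBranch z w) :
    IntervalIntegrable (fun s => w s * z) volume 0 1 := by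
  rcases eq_or_ne z 0 with rfl | hz
  · simp
  refine IntervalIntegrable.mul_const ?_ z
  have hz0 : 0 < ‖z‖ := norm_pos_iff.2 hz
  set C : ℝ := (‖z‖ + 1) * (2 * ‖z‖) * (2 * ‖z‖) / ‖z‖ with hC
  have hC0 : 0 ≤ C := by positivity
  have hg : IntervalIntegrable (fun s : ℝ => √C * s ^ (-(1 / 2) : ℝ)) volume 0 1 :=
    (intervalIntegral.intervalIntegrable_rpow' (by norm_num)).const_mul _
  rw [intervalIntegrable_iff_integrableOn_Ioo_of_le zero_le_one] at hg ⊢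
  refine Integrable.mono' hg (hw.1.aestronglyMeasurable measurableSet_Ioo) ?_
  filter_upwards [ae_restrict_mem measurableSet_Ioo] with s hs
  have hsn : ‖(s : ℂ) * z‖ ≤ ‖z‖ := by
    rw [norm_mul, Complex.norm_real, Real.norm_of_nonneg hs.1.le]
    exact mul_le_of_le_one_left hz0.le hs.2.le
  have h1 : ‖(s : ℂ) * z - 1‖ ≤ ‖z‖ + 1 := (norm_sub_le _ _).trans (by simpa using hsn)
  have h2 : ‖(s : ℂ) * z - z‖ ≤ 2 * ‖z‖ := (norm_sub_le _ _).trans (by linarith)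
  have h3 : ‖(s : ℂ) * z - (starRingEnd ℂ) z‖ ≤ 2 * ‖z‖ :=
    (norm_sub_le _ _).trans (by rw [RCLike.norm_conj]; linarith)
  have h4 : ‖w s‖ ^ 2 ≤ C / s := by
    rw [← norm_pow, hw.2 s hs, radicand, norm_div, norm_mul, norm_mul, norm_mul (s : ℂ) z,
      Complex.norm_real, Real.norm_of_nonneg hs.1.le, hC, div_div, mul_comm ‖z‖ s]
    have := hs.1
    gcongr
  calc ‖w s‖ ≤ √(C / s) := Real.le_sqrt_of_sq_le h4
    _ = √C * s ^ (-(1 / 2) : ℝ) := by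
      rw [Real.sqrt_div hC0, Real.rpow_neg hs.1.le, ← Real.sqrt_eq_rpow, div_eq_mul_inv]

theorem mem_sigmaSet_iff {z : ℂ} :
    z ∈ sigmaSet ↔ ∃ w, IsSqrtBranch z w ∧ ∫ s in (0 : ℝ)..1, (w s * z).re = 0 := by
  constructor
  · rintro ⟨w, hw, hi, h⟩
    exact ⟨w, hw, by rwa [re_intervalIntegral hi] at h⟩
  · rintro ⟨w, hw, h⟩
    exact ⟨w, hw, hw.intervalIntegrable, by rwa [re_intervalIntegral hw.intervalIntegrable]⟩

theorem conj_mem_sigmaSet {z : ℂ} (hz : z ∈ sigmaSet) : (starRingEnd ℂ) z ∈ sigmaSet := by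
  obtain ⟨w, hw, h⟩ := mem_sigmaSet_iff.1 hz
  refine mem_sigmaSet_iff.2 ⟨fun s => (starRingEnd ℂ) (w s),
    ⟨Complex.continuous_conj.comp_continuousOn hw.1, fun s hs => ?_⟩, ?_⟩
  · rw [← map_pow, hw.2 s hs]
    simp only [radicand, map_div₀, map_mul, map_sub, map_one, Complex.conj_conj, Complex.conj_ofReal]
  · refine (intervalIntegral.integral_congr fun s _ => ?_).trans h
    simp only [← map_mul, Complex.conj_re]

theorem conj_mem_sigmaSet_iff {z : ℂ} : (starRingEnd ℂ) z ∈ sigmaSet ↔ z ∈ sigmaSet :=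
  ⟨fun h => by simpa using conj_mem_sigmaSet h, conj_mem_sigmaSet⟩

theorem intervalIntegral_ne_zero_of_ne_zero_on {f : ℝ → ℝ} {a b : ℝ} (hab : a < b)
    (hf : ContinuousOn f (Ioo a b)) (hi : IntervalIntegrable f volume a b)
    (h0 : ∀ s ∈ Ioo a b, f s ≠ 0) : ∫ s in a..b, f s ≠ 0 := by
  have hsign : (∀ s ∈ Ioo a b, 0 < f s) ∨ ∀ s ∈ Ioo a b, f s < 0 := by
    by_contra! hcon
    obtain ⟨⟨s, hs, hs'⟩, t, ht, ht'⟩ := hcon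
    obtain ⟨c, hc, hc'⟩ := isPreconnected_Ioo.intermediate_value hs ht hf ⟨hs', ht'⟩
    exact h0 c hc hc'
  rcases hsign with h | h
  · exact (intervalIntegral.intervalIntegral_pos_of_pos_on hi h hab).ne'
  · have := intervalIntegral.intervalIntegral_pos_of_pos_on hi.neg
      (fun s hs => neg_pos.2 (h s hs)) hab
    simp at this
    exact this.ne

/-- If the real part of the integrand vanishes up to `a` and nowhere after `a`, it has a constant
sign after `a`, and the integral has nonzero real part. -/
theorem IsSqrtBranch.integral_re_ne_zero {z : ℂ} {w : ℝ → ℂ} (hw : IsSqrtBranch z w) {a : ℝ}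
    (ha : a ∈ Ico (0 : ℝ) 1) (h0 : ∀ s ∈ Ioc 0 a, (w s * z).re = 0)
    (h1 : ∀ s ∈ Ioo a 1, (w s * z).re ≠ 0) : ∫ s in (0 : ℝ)..1, (w s * z).re ≠ 0 := by
  have hi : IntervalIntegrable (fun s => (w s * z).re) volume 0 1 :=
    ⟨hw.intervalIntegrable.1.re, hw.intervalIntegrable.2.re⟩
  have hi0 : IntervalIntegrable (fun s => (w s * z).re) volume 0 a := hi.mono_set (by
    rw [uIcc_of_le ha.1, uIcc_of_le zero_le_one]; exact Icc_subset_Icc_right ha.2.le)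
  have hi1 : IntervalIntegrable (fun s => (w s * z).re) volume a 1 := hi.mono_set (by
    rw [uIcc_of_le ha.2.le, uIcc_of_le zero_le_one]; exact Icc_subset_Icc_left ha.1)
  have hz : ∫ s in (0 : ℝ)..a, (w s * z).re = 0 := by
    rw [intervalIntegral.integral_of_le ha.1]
    exact setIntegral_eq_zero_of_forall_eq_zero h0
  rw [← intervalIntegral.integral_add_adjacent_intervals hi0 hi1, hz, zero_add]
  refine intervalIntegral_ne_zero_of_ne_zero_on ha.2 ?_ hi1 h1
  exact Complex.continuous_re.comp_continuousOn
    ((hw.1.mono (Ioo_subset_Ioo_left ha.1)).mul continuousOn_const)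

/-- A number with zero real part has a real nonpositive square. -/
theorem re_ne_zero_of_sq_eq_neg_mul {f p : ℂ} {k : ℝ} (hk : 0 < k)
    (h : f ^ 2 = ((-k : ℝ) : ℂ) * p) (hp : p.im = 0 → p.re < 0) : f.re ≠ 0 := by
  intro hf
  have h1 := congrArg Complex.re h
  have h2 := congrArg Complex.im h
  rw [Complex.re_ofReal_mul] at h1
  rw [Complex.im_ofReal_mul] at h2
  simp [pow_two, hf] at h1 h2
  have h3 := hp (h2.resolve_left hk.ne')
  nlinarith [mul_self_nonneg f.im, mul_neg_of_pos_of_neg hk h3]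

/-- For `Re z ≤ 0 < Im z` the polynomial factor of `IsSqrtBranch.mul_sq` is a product of a number in
the open upper half plane and one in the right half plane with nonnegative imaginary part, hence
not a nonnegative real. -/
theorem not_mem_sigmaSet_of_re_nonpos {z : ℂ} (hx : z.re ≤ 0) (hy : 0 < z.im) :
    z ∉ sigmaSet := by
  intro hz
  obtain ⟨w, hw, h⟩ := mem_sigmaSet_iff.1 hz
  have hz0 : z ≠ 0 := by rintro rfl; simp at hy
  refine hw.integral_re_ne_zero ⟨le_rfl, zero_lt_one⟩ (by simp) (fun s hs => ?_) h
  refine re_ne_zero_of_sq_eq_neg_mul (div_pos (sub_pos.2 hs.2) hs.1) (hw.mul_sq hz0 hs) ?_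
  have hs0 := hs.1
  have hs1 := hs.2
  have hpi : 0 < (z * (1 - s * z)).im := by
    simp
    nlinarith [mul_nonneg hs.1.le (mul_nonneg (neg_nonneg.2 hx) hy.le)]
  have hai : 0 ≤ (z * (starRingEnd ℂ) z - s * z ^ 2).im := by
    simp [pow_two]
    nlinarith [mul_nonneg hs.1.le (mul_nonneg (neg_nonneg.2 hx) hy.le)]
  have har : 0 < (z * (starRingEnd ℂ) z - s * z ^ 2).re := by
    simp [pow_two]
    nlinarith [mul_nonneg (sub_nonneg.2 hs.2.le) (mul_self_nonneg z.re), mul_pos hy hy,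
      mul_pos hs.1 (mul_pos hy hy)]
  generalize z * (1 - s * z) = p at *
  generalize z * (starRingEnd ℂ) z - s * z ^ 2 = a at *
  intro h0
  rw [Complex.mul_im] at h0
  rw [Complex.mul_re]
  have h1 := mul_pos hpi har
  have h2 : p.re < 0 := by nlinarith
  nlinarith [mul_neg_of_neg_of_pos h2 har, mul_nonneg hpi.le hai]

theorem ofReal_mem_sigmaSet_iff {x : ℝ} : (x : ℂ) ∈ sigmaSet ↔ x ∈ Icc (0 : ℝ) 1 := by
  constructor
  · intro hx
    by_contra hn
    obtain ⟨w, hw, h⟩ := mem_sigmaSet_iff.1 hx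
    have hx0 : x ≠ 0 := by rintro rfl; exact hn ⟨le_rfl, zero_le_one⟩
    have hP : ∀ s : ℝ, ((x : ℂ) * (1 - s * x) * (x * (starRingEnd ℂ) (x : ℂ) - s * (x : ℂ) ^ 2)) =
        ((x ^ 3 * (1 - s) * (1 - s * x) : ℝ) : ℂ) := by
      intro s; simp; ring
    have hsq : ∀ s ∈ Ioo (0 : ℝ) 1, (w s * x) ^ 2 =
        ((-((1 - s) / s) : ℝ) : ℂ) * ((x ^ 3 * (1 - s) * (1 - s * x) : ℝ) : ℂ) := fun s hs => by
      rw [← hP]; exact hw.mul_sq (by exact_mod_cast hx0) hs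
    rcases lt_or_ge x 0 with h0 | h0
    · refine hw.integral_re_ne_zero ⟨le_rfl, zero_lt_one⟩ (by simp) (fun s hs => ?_) h
      refine re_ne_zero_of_sq_eq_neg_mul (div_pos (sub_pos.2 hs.2) hs.1) (hsq s hs) fun _ => ?_
      rw [Complex.ofReal_re]
      have a : x ^ 3 < 0 := Odd.pow_neg (by decide) h0
      have b : 0 < 1 - s * x := by nlinarith [hs.1]
      exact mul_neg_of_neg_of_pos (mul_neg_of_neg_of_pos a (sub_pos.2 hs.2)) b
    · have h1 : 1 < x := by
        by_contra! h1; exact hn ⟨h0, h1⟩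
      have hxp : 0 < x := by linarith
      refine hw.integral_re_ne_zero (a := 1 / x) ⟨by positivity, (div_lt_one hxp).2 h1⟩
        (fun s hs => ?_) (fun s hs => ?_) h
      -- Before the branch point `s = 1 / x` the square of the integrand is real and nonpositive.
      · have hs1 : s ∈ Ioo (0 : ℝ) 1 := ⟨hs.1, hs.2.trans_lt ((div_lt_one hxp).2 h1)⟩
        have hsx : s * x ≤ 1 := (le_div_iff₀ hxp).1 hs.2
        have e := hsq s hs1
        rw [← Complex.ofReal_mul] at e
        have k0 : 0 ≤ (1 - s) / s * (x ^ 3 * (1 - s) * (1 - s * x)) :=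
          mul_nonneg (div_nonneg (by linarith [hs1.2]) hs.1.le)
            (mul_nonneg (mul_nonneg (by positivity) (by linarith [hs1.2])) (by linarith))
        have e1 := congrArg Complex.re e
        have e2 := congrArg Complex.im e
        rw [Complex.ofReal_re] at e1
        rw [Complex.ofReal_im] at e2
        generalize w s * x = f at e1 e2
        simp [pow_two] at e1 e2
        by_contra hf
        have him : f.im = 0 := by
          rcases mul_eq_zero.1 (show f.re * f.im = 0 by linarith) with h | h
          · exact absurd h hf
          · exact h
        rw [him] at e1
        have := mul_self_pos.2 hf
        linarith
      -- Beyond it the square is real and positive.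
      · have hs1 : s ∈ Ioo (0 : ℝ) 1 := ⟨lt_trans (by positivity) hs.1, hs.2⟩
        have hsx : 1 < s * x := (div_lt_iff₀ hxp).1 hs.1
        refine re_ne_zero_of_sq_eq_neg_mul (div_pos (sub_pos.2 hs.2) hs1.1) (hsq s hs1) fun _ => ?_
        rw [Complex.ofReal_re]
        exact mul_neg_of_pos_of_neg (mul_pos (by positivity) (sub_pos.2 hs.2)) (by linarith)
  · rintro ⟨h0, h1⟩
    refine mem_sigmaSet_iff.2 ⟨fun s => Complex.I * ((1 - s) * √((1 - s * x) * x / s) : ℝ),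
      ⟨?_, fun s hs => ?_⟩, ?_⟩
    · refine continuousOn_const.mul (Complex.continuous_ofReal.comp_continuousOn ?_)
      refine ContinuousOn.mul (by fun_prop) (ContinuousOn.sqrt (ContinuousOn.div (by fun_prop)
        (by fun_prop) fun s hs => hs.1.ne'))
    · have hs0 : (s : ℂ) ≠ 0 := by exact_mod_cast hs.1.ne'
      have hsx : s * x ≤ 1 := mul_le_one₀ hs.2.le h0 h1
      rw [mul_pow, Complex.I_sq, ← Complex.ofReal_pow, mul_pow, Real.sq_sqrt
        (div_nonneg (mul_nonneg (by linarith) h0) hs.1.le), radicand, Complex.conj_ofReal]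
      rcases eq_or_ne x 0 with rfl | hx0
      · simp
      · have hx0' : (x : ℂ) ≠ 0 := by exact_mod_cast hx0
        push_cast
        field_simp
        ring
    · simp

/-- The substitution `s = u ^ 2` for an integrand that may be singular at `0`. -/
theorem intervalIntegral_comp_sq {f B : ℝ → ℂ} (hf : ContinuousOn f (Ioo 0 1))
    (hi : IntervalIntegrable f volume 0 1) (hB : ContinuousOn B (Icc 0 1))
    (h : ∀ u ∈ Ioo (0 : ℝ) 1, f (u ^ 2) * (2 * u) = B u) :
    ∫ s in (0 : ℝ)..1, f s = ∫ u in (0 : ℝ)..1, B u := by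
  have himg : (fun u : ℝ => u ^ 2) '' Icc 0 1 ⊆ Icc 0 1 := by
    rintro _ ⟨u, hu, rfl⟩
    exact ⟨sq_nonneg u, pow_le_one₀ hu.1 hu.2⟩
  have himg' : (fun u : ℝ => u ^ 2) '' Ioo 0 1 ⊆ Ioo 0 1 := by
    rintro _ ⟨u, hu, rfl⟩
    exact ⟨pow_pos hu.1 2, pow_lt_one₀ hu.1.le hu.2 two_ne_zero⟩
  have e : ∀ u ∈ Ioo (0 : ℝ) 1, B u = (2 * u) • (f ∘ fun u => u ^ 2) u := fun u hu => by
    rw [← h u hu, Complex.real_smul, Function.comp_apply]; push_cast; ring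
  have key := intervalIntegral.integral_deriv_smul_comp''' (a := 0) (b := 1)
    (f := fun u : ℝ => u ^ 2) (f' := fun u => 2 * u) (g := f) (by fun_prop)
    (fun u _ => by simpa using (hasDerivAt_pow 2 u).hasDerivWithinAt)
    (by simpa using hf.mono himg')
    (by
      rw [uIcc_of_le zero_le_one]
      exact IntegrableOn.mono_set ((intervalIntegrable_iff_integrableOn_Icc_of_le zero_le_one).1 hi)
        himg)
    (by
      rw [uIcc_of_le zero_le_one, integrableOn_Icc_iff_integrableOn_Ioo]
      exact ((hB.integrableOn_Icc).mono_set Ioo_subset_Icc_self).congr_fun e measurableSet_Ioo)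
  simp only [ne_eq, OfNat.ofNat_ne_zero, not_false_eq_true, zero_pow, one_pow] at key
  rw [← key, intervalIntegral.integral_of_le zero_le_one, intervalIntegral.integral_of_le
    zero_le_one, integral_Ioc_eq_integral_Ioo, integral_Ioc_eq_integral_Ioo]
  exact (setIntegral_congr_fun measurableSet_Ioo e).symm

/-- After `s = u ^ 2`, any branch along the segment is `± i` times the regular integrand
`pulledRoot`, since both have the same square and no zero. -/
theorem mem_sigmaSet_iff_levelFun {z : ℂ} (hx : 0 < z.re) (hy : 0 < z.im) :
    z ∈ sigmaSet ↔ levelFun z.re z.im = 0 := by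
  have hz0 : z ≠ 0 := by rintro rfl; simp at hy
  set A : ℝ → ℂ := fun u => pulledRoot z.re z.im (u * Complex.sqrt z) * Complex.sqrt z with hA
  have hAc : ContinuousOn A (Icc 0 1) := by
    have := continuousOn_pulledRoot_ray (x := z.re) hy.le (right_mem_Icc.2 zero_le_one)
    simpa [hA] using this
  have hAl : (∫ u in (0 : ℝ)..1, A u).im = levelFun z.re z.im := by
    have := im_integral_pulledRoot_eq_levelFun hx hy
    simpa [hA] using this
  have hfac : ∀ t : ℂ, (t - z.re) ^ 2 + (z.im : ℂ) ^ 2 = (t - z) * (t - (starRingEnd ℂ) z) := by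
    intro t
    have h1 := Complex.add_conj z
    have h2 := Complex.mul_conj z
    rw [Complex.normSq_apply] at h2
    push_cast at h1 h2
    linear_combination t * h1 - h2
  have hAsq : ∀ u : ℝ, A u ^ 2 = 4 * (1 - u ^ 2 * z) *
      ((u ^ 2 * z - z) * (u ^ 2 * z - (starRingEnd ℂ) z)) * z := by
    intro u
    have e : ((u : ℂ) * Complex.sqrt z) ^ 2 = u ^ 2 * z := by rw [mul_pow, Complex.sq_sqrt_self]
    simp only [hA, pulledRoot]
    rw [e, mul_pow, mul_pow, mul_pow, upperSqrtOneSub_sq, Complex.sq_sqrt_self,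
      Complex.sq_sqrt_self, hfac]
    ring
  have hA0 : ∀ u ∈ Ioo (0 : ℝ) 1, A u ≠ 0 := by
    intro u hu h
    have h1 := hAsq u
    rw [h] at h1
    have hu2 : u ^ 2 < 1 := pow_lt_one₀ hu.1.le hu.2 two_ne_zero
    have hu0 : 0 < u ^ 2 := pow_pos hu.1 2
    have n1 : (1 - u ^ 2 * z : ℂ) ≠ 0 := fun h => by
      have := congrArg Complex.im h
      simp [← Complex.ofReal_pow, hu.1.ne', hy.ne'] at this
    have n2 : (u ^ 2 * z - z : ℂ) ≠ 0 := fun h => by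
      have := congrArg Complex.im h
      simp [← Complex.ofReal_pow] at this
      nlinarith
    have n3 : (u ^ 2 * z - (starRingEnd ℂ) z : ℂ) ≠ 0 := fun h => by
      have := congrArg Complex.im h
      simp [← Complex.ofReal_pow] at this
      nlinarith
    simp [n1, n2, n3, hz0] at h1
  rw [mem_sigmaSet_iff, ← hAl]
  constructor
  · rintro ⟨w, hw, h⟩
    have hWc : ContinuousOn (fun u : ℝ => w (u ^ 2) * z * (2 * u)) (Ioo 0 1) := by
      refine ContinuousOn.mul (ContinuousOn.mul (hw.1.comp (by fun_prop) fun u hu => ?_)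
        continuousOn_const) (by fun_prop)
      exact ⟨pow_pos hu.1 2, pow_lt_one₀ hu.1.le hu.2 two_ne_zero⟩
    have hIA : ContinuousOn (fun u => Complex.I * A u) (Icc 0 1) := continuousOn_const.mul hAc
    have hsq : EqOn ((fun u : ℝ => w (u ^ 2) * z * (2 * u)) ^ 2)
        ((fun u => Complex.I * A u) ^ 2) (Ioo 0 1) := by
      intro u hu
      have hu0 : (u : ℂ) ≠ 0 := by exact_mod_cast hu.1.ne'
      have := hw.2 (u ^ 2) ⟨pow_pos hu.1 2, pow_lt_one₀ hu.1.le hu.2 two_ne_zero⟩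
      simp only [Pi.pow_apply]
      rw [mul_pow, mul_pow, this, mul_pow Complex.I, hAsq, Complex.I_sq, radicand]
      push_cast
      field_simp
      ring
    have hre := re_intervalIntegral hw.intervalIntegrable
    have him : ∀ ε : ℂ, (∀ u ∈ Ioo (0 : ℝ) 1, w (u ^ 2) * z * (2 * u) = ε * (Complex.I * A u)) →
        ∫ s in (0 : ℝ)..1, w s * z = ε * (Complex.I * ∫ u in (0 : ℝ)..1, A u) := by
      intro ε hε
      rw [intervalIntegral_comp_sq (f := fun s => w s * z) (hw.1.mul continuousOn_const) hw.intervalIntegrable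
        (B := fun u => ε * (Complex.I * A u)) (continuousOn_const.mul hIA) hε, intervalIntegral.integral_const_mul,
        intervalIntegral.integral_const_mul]
    rw [h] at hre
    rcases isPreconnected_Ioo.eq_or_eq_neg_of_sq_eq hWc (hIA.mono Ioo_subset_Icc_self) hsq
      (fun {u} hu => mul_ne_zero Complex.I_ne_zero (hA0 u hu)) with h' | h'
    · rw [him 1 fun u hu => by rw [one_mul]; exact h' hu] at hre
      simpa using hre
    · rw [him (-1) fun u hu => by rw [neg_one_mul]; exact h' hu] at hre
      simpa using hre
  · intro h
    set w : ℝ → ℂ := fun s => Complex.I * A (√s) / (2 * (√s : ℝ) * z) with hw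
    have hsq0 : ∀ s ∈ Ioo (0 : ℝ) 1, ((√s : ℝ) : ℂ) ≠ 0 := fun s hs => by
      exact_mod_cast (Real.sqrt_pos.2 hs.1).ne'
    have hb : IsSqrtBranch z w := by
      refine ⟨ContinuousOn.div (continuousOn_const.mul (hAc.comp (by fun_prop) fun s hs =>
        ⟨Real.sqrt_nonneg s, Real.sqrt_le_one.2 hs.2.le⟩)) (by fun_prop) fun s hs =>
          mul_ne_zero (mul_ne_zero two_ne_zero (hsq0 s hs)) hz0, fun s hs => ?_⟩
      have e : ((√s : ℝ) : ℂ) ^ 2 = s := by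
        rw [← Complex.ofReal_pow, Real.sq_sqrt hs.1.le]
      have hs0 : (s : ℂ) ≠ 0 := by exact_mod_cast hs.1.ne'
      have e2 : (2 * ((√s : ℝ) : ℂ) * z) ^ 2 = 4 * s * z ^ 2 := by rw [← e]; ring
      simp only [hw]
      rw [div_pow, mul_pow Complex.I, hAsq, Complex.I_sq, e2, e, radicand]
      field_simp
      ring
    refine ⟨w, hb, ?_⟩
    rw [← re_intervalIntegral hb.intervalIntegrable,
      intervalIntegral_comp_sq (f := fun s => w s * z) (hb.1.mul continuousOn_const) hb.intervalIntegrable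
        (continuousOn_const.mul hAc) (B := fun u => Complex.I * A u) fun u hu => ?_,
      intervalIntegral.integral_const_mul]
    · simpa using h
    · have hu0 : (u : ℂ) ≠ 0 := by exact_mod_cast hu.1.ne'
      simp only [hw]
      rw [Real.sqrt_sq hu.1.le]
      field_simp

theorem mem_sigmaSet_iff_of_im_pos {z : ℂ} (hy : 0 < z.im) :
    z ∈ sigmaSet ↔ z.re = sigmaAbscissa z.im := by
  have h1 := one_le_sigmaAbscissa z.im
  rcases le_or_gt z.re 0 with hx | hx
  · exact iff_of_false (not_mem_sigmaSet_of_re_nonpos hx hy) (by linarith)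
  rw [mem_sigmaSet_iff_levelFun hx hy]
  rcases lt_or_ge z.re 1 with h | h
  · exact iff_of_false (levelFun_pos_of_le_one hx h.le hy).ne' (by linarith)
  · exact levelFun_eq_zero_iff h

/-! ### Arcs -/

theorem mem_segment_zero_one_iff {z : ℂ} :
    z ∈ segment ℝ (0 : ℂ) 1 ↔ z.im = 0 ∧ z.re ∈ Icc (0 : ℝ) 1 := by
  rw [segment_eq_image]
  constructor
  · rintro ⟨t, ht, rfl⟩
    simpa using ht
  · rintro ⟨h0, h1⟩
    exact ⟨z.re, h1, by apply Complex.ext <;> simp [h0]⟩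

theorem isJordanArc_segment_zero_one : IsJordanArc (segment ℝ (0 : ℂ) 1) 0 1 := by
  refine ⟨fun t => t, by fun_prop, Complex.ofReal_injective.injOn, by simp, by simp, ?_⟩
  rw [segment_eq_image]
  simp

/-- The graph of a continuous function over the half axis `ε y`, `y ≥ 0`, where `ε = ±1`. -/
theorem isJordanArcToInfinity_graph {f : ℝ → ℝ} (hf : Continuous f) (h0 : f 0 = 1) {ε : ℝ}
    (hε : |ε| = 1) :
    IsJordanArcToInfinity ((fun y : ℝ => (f y + (ε * y : ℝ) * Complex.I : ℂ)) '' Ici 0) 1 := by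
  have hε0 : ε ≠ 0 := by rintro rfl; simp at hε
  refine ⟨_, by fun_prop, fun a _ b _ h => ?_, by simp [h0], ?_, rfl⟩
  · have := congrArg Complex.im h
    simpa [hε0] using this
  · rw [← Metric.cobounded_eq_cocompact, ← tendsto_norm_atTop_iff_cobounded]
    refine tendsto_atTop_mono (fun y => ?_) tendsto_id
    refine le_trans ?_ (Complex.abs_im_le_norm _)
    simp [abs_mul, hε, le_abs_self]

theorem mainTheorem3 :
    (∀ z : ℂ, (starRingEnd ℂ) z ∈ sigmaSet ↔ z ∈ sigmaSet) ∧
    ∃ Sp Sm : Set ℂ,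
      sigmaSet = segment ℝ (0 : ℂ) 1 ∪ Sp ∪ Sm ∧
      IsJordanArc (segment ℝ (0 : ℂ) 1) 0 1 ∧
      IsJordanArcToInfinity Sp 1 ∧ (∀ z ∈ Sp, z ≠ 1 → 0 < z.im) ∧
      IsJordanArcToInfinity Sm 1 ∧ (∀ z ∈ Sm, z ≠ 1 → z.im < 0) := by
  -- `ε = 1` gives the upper curve and `ε = -1` the lower one.
  have hmem : ∀ (ε : ℝ) (z : ℂ), ε ^ 2 = 1 →
      (z ∈ (fun y : ℝ => (sigmaAbscissa y + (ε * y : ℝ) * Complex.I : ℂ)) '' Ici 0 ↔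
        0 ≤ ε * z.im ∧ z.re = sigmaAbscissa (ε * z.im)) := by
    intro ε z hε
    constructor
    · rintro ⟨y, hy, rfl⟩
      have : ε * (ε * y) = y := by rw [← mul_assoc, ← pow_two, hε, one_mul]
      simpa [this] using hy
    · rintro ⟨h0, h1⟩
      refine ⟨ε * z.im, h0, Complex.ext (by simp [h1]) ?_⟩
      simp [← mul_assoc, ← pow_two, hε]
  have hreal : ∀ z : ℂ, z.im = 0 → (z : ℂ) = (z.re : ℝ) := fun z h => Complex.ext rfl (by simp [h])
  have hne : ∀ (ε : ℝ) (z : ℂ), z.re = sigmaAbscissa (ε * z.im) → z ≠ 1 → z.im ≠ 0 := by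
    intro ε z h hz h0
    rw [h0, mul_zero, sigmaAbscissa_zero] at h
    exact hz (Complex.ext h h0)
  refine ⟨fun z => conj_mem_sigmaSet_iff, _, _, ?_, isJordanArc_segment_zero_one,
    isJordanArcToInfinity_graph continuous_sigmaAbscissa sigmaAbscissa_zero (ε := 1) (by simp), ?_,
    isJordanArcToInfinity_graph continuous_sigmaAbscissa sigmaAbscissa_zero (ε := -1) (by simp), ?_⟩
  · ext z
    rw [mem_union, mem_union, mem_segment_zero_one_iff, hmem 1 z (by norm_num),
      hmem (-1) z (by norm_num), one_mul, neg_one_mul]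
    rcases lt_trichotomy z.im 0 with h | h | h
    · rw [← conj_mem_sigmaSet_iff, mem_sigmaSet_iff_of_im_pos (by simpa using h)]
      simp [h.ne, h.not_ge, h.le]
    · rw [hreal z h, ofReal_mem_sigmaSet_iff]
      simp [sigmaAbscissa_zero]
      intro h
      simp [h]
    · rw [mem_sigmaSet_iff_of_im_pos h]
      simp [h.ne', h.not_ge, h.le]
  · intro z hz h1
    rw [hmem 1 z (by norm_num)] at hz
    exact lt_of_le_of_ne (by simpa using hz.1) (hne 1 z hz.2 h1).symm
  · intro z hz h1
    rw [hmem (-1) z (by norm_num)] at hz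
    exact lt_of_le_of_ne (by simpa using hz.1) (hne (-1) z hz.2 h1)
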